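/- Let $a>0$, $l\ge 0$ and let $k\ge 1$ be an integer. Consider the cylinder $(x^1)^2+(x^2)^2=a^2$ in $\mathbb{R}^3$ and the light rays issuing from the point $(-l,0,0)$, parameterized by the stereographic coordinate $\xi=\tan(\theta/2)e^{i\phi}=u e^{iv}$ ($u>0$, $v\in\mathbb{R}$) of their direction (projection from the south pole). Only those rays are considered that, at a non-negative distance from the source, hit the cylinder transversally from the inside; whether this is so depends on $v$ alone. Let each of them be reflected $k$ times off the inside of the cylinder, and consider the $2$-parameter family of oriented lines (line congruence) so obtained. A focal point of this congruence is a point $p$ on one of its (full) lines such that the optical scalars $(\rho,\sigma)$ of the congruence, $\rho=-\langle\nabla_{e_+}e_0,e_-\rangle$, $\sigma=-\langle\nabla_{e_+}e_0,e_+\rangle$, blow up as one moves along the line to $p$; here $e_0$ is the unit direction field of the congruence and $e_\pm=(e_1\mp i e_2)/\sqrt2$ for an oriented orthonormal frame $(e_0,e_1,e_2)$. Let the focal surface $S$ be the closure of the part of the focal set (the set of all focal points) that lies off the plane $x^3=0$ (which leaves out the focal curve contained in this plane). Then $S$ is invariant under translation along the axis of the cylinder: $S+(0,0,t)=S$ for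 every $t\in\mathbb{R}$. Moreover, the $x^1$ and $x^2$ coordinates of the focal surface do not depend on $u$: if $p$ is a focal point with $x^3\neq0$ on the $k$-fold reflection of the ray $\xi=ue^{iv}$, then for every $u'>0$ the ray $\xi'=u'e^{iv}$ is also reflected, its $k$-fold reflection carries a focal point with the same $x^1$ and $x^2$ as $p$ (and with $x^3\ne0$ if $u'\neq1$), and every focal point with $x^3\neq 0$ on it has the same $x^1$ and $x^2$ as $p$. -/

import Mathlib

open Filter Topology

noncomputable section

namespace FocalCylinder

/-- Euclidean 3-space with coordinates `x¹ = x 0`, `x² = x 1`, `x³ = x 2`. -/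
abbrev E3 : Type := EuclideanSpace ℝ (Fin 3)

/-- An oriented line, given by one of its points and its direction vector (a unit vector for
all the lines below). The focal points on a line do not depend on the chosen base point. -/
structure OrientedLine where
  base : E3
  dir : E3

/-- The point of the line at signed distance `r` from the base point (for a unit direction). -/
def OrientedLine.point (γ : OrientedLine) (r : ℝ) : E3 := γ.base + r • γ.dir

/-! ### Optical scalars and focal points of a line congruence -/

/-- The map `(μ, r) ↦` point with affine parameter `r` on the line `γ μ`, for a line congruence
`γ` with a parameter `μ ∈ ℂ`. -/
def pointMap (γ : ℂ → OrientedLine) (x : ℂ × ℝ) : E3 := (γ x.1).point x.2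

/-- Where `pointMap γ` is a local diffeomorphism, the directions of the lines form a local unit
vector field `e₀` on space, `e₀ (pointMap γ (μ, r)) = (γ μ).dir`. This is its derivative
`X ↦ ∇_X e₀` at the point `pointMap γ (μ, r)`, computed by the chain rule. -/
def gradDir (γ : ℂ → OrientedLine) (μ : ℂ) (r : ℝ) : E3 →L[ℝ] E3 :=
  (fderiv ℝ (fun ν => (γ ν).dir) μ).comp
    ((ContinuousLinearMap.fst ℝ ℂ ℝ).comp (fderiv ℝ (pointMap γ) (μ, r)).inverse)

/-- `e₀, e₁, e₂` is an orthonormal frame with the standard orientation. -/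
def IsFrame (e₀ e₁ e₂ : E3) : Prop :=
  Orthonormal ℝ ![e₀, e₁, e₂] ∧
    (Matrix.of fun i j : Fin 3 => (![e₀, e₁, e₂] i) j).det = 1

/-- `⟨∇_{eᵢ} e₀, eⱼ⟩`. -/
def gradComp (γ : ℂ → OrientedLine) (μ : ℂ) (r : ℝ) (x y : E3) : ℝ :=
  inner ℝ (gradDir γ μ r x) y

/-- The optical scalar `ρ = -⟨∇_{e₊} e₀, e₋⟩` with respect to the null frame
`e₊ = (e₁ - i e₂)/√2`, `e₋ = (e₁ + i e₂)/√2`, where `⟨·,·⟩` is extended complex bilinearly. -/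
def opticalRho (γ : ℂ → OrientedLine) (e₁ e₂ : E3) (μ : ℂ) (r : ℝ) : ℂ :=
  -(((gradComp γ μ r e₁ e₁ + gradComp γ μ r e₂ e₂ : ℝ) : ℂ)
    + Complex.I * ((gradComp γ μ r e₁ e₂ - gradComp γ μ r e₂ e₁ : ℝ) : ℂ)) / 2

/-- The optical scalar `σ = -⟨∇_{e₊} e₀, e₊⟩` (the shear). -/
def opticalSigma (γ : ℂ → OrientedLine) (e₁ e₂ : E3) (μ : ℂ) (r : ℝ) : ℂ :=
  -(((gradComp γ μ r e₁ e₁ - gradComp γ μ r e₂ e₂ : ℝ) : ℂ)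
    - Complex.I * ((gradComp γ μ r e₁ e₂ + gradComp γ μ r e₂ e₁ : ℝ) : ℂ)) / 2

/-- The point with parameter `r` on the line `γ μ` is a focal point: the optical scalars `(ρ, σ)`
blow up there along the line. (`|ρ|` and `|σ|` do not depend on the frame.) -/
def IsFocalAt (γ : ℂ → OrientedLine) (μ : ℂ) (r : ℝ) : Prop :=
  ∃ e₁ e₂ : E3, IsFrame (γ μ).dir e₁ e₂ ∧
    Tendsto (fun r' : ℝ => ‖(opticalRho γ e₁ e₂ μ r', opticalSigma γ e₁ e₂ μ r')‖)
      (𝓝[≠] r) atTop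

/-- The set of focal points on the line `γ μ`. -/
def focalPointsOn (γ : ℂ → OrientedLine) (μ : ℂ) : Set E3 :=
  {p | ∃ r : ℝ, IsFocalAt γ μ r ∧ p = (γ μ).point r}

/-- The focal set of the line congruence `γ` with parameter domain `D`. -/
def focalSet (γ : ℂ → OrientedLine) (D : Set ℂ) : Set E3 :=
  {p | ∃ μ ∈ D, p ∈ focalPointsOn γ μ}

/-! ### Reflection off the inside of a cylinder -/

/-- Scalar product of the projections to the `x¹x²`-plane. -/
def hdot (x y : E3) : ℝ := x 0 * y 0 + x 1 * y 1

/-- Discriminant of the quadratic equation `hdot (γ.point r) (γ.point r) = a ^ 2` for `r`. -/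
def cylDisc (a : ℝ) (γ : OrientedLine) : ℝ :=
  hdot γ.base γ.dir ^ 2 - hdot γ.dir γ.dir * (hdot γ.base γ.base - a ^ 2)

/-- The line is not parallel to the axis and crosses the cylinder of radius `a` transversally. -/
def CrossesCylinder (a : ℝ) (γ : OrientedLine) : Prop :=
  0 < hdot γ.dir γ.dir ∧ 0 < cylDisc a γ

/-- The larger root of `hdot (γ.point r) (γ.point r) = a ^ 2`: the parameter of the point at which
the oriented line leaves the cylinder, that is, hits its wall from the inside. -/
def exitParam (a : ℝ) (γ : OrientedLine) : ℝ :=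
  (-hdot γ.base γ.dir + √(cylDisc a γ)) / hdot γ.dir γ.dir

/-- The outward unit normal of the cylinder of radius `a` at its point `q`. -/
def cylNormal (a : ℝ) (q : E3) : E3 := !₂[q 0 / a, q 1 / a, 0]

/-- Reflection of an oriented line off the inside of the cylinder `(x¹)² + (x²)² = a²`. -/
def cylReflect (a : ℝ) (γ : OrientedLine) : OrientedLine where
  base := γ.point (exitParam a γ)
  dir := γ.dir - (2 * inner ℝ γ.dir (cylNormal a (γ.point (exitParam a γ)))) •
    cylNormal a (γ.point (exitParam a γ))

/-- The unit vector with stereographic coordinate `ξ = tan (θ / 2) * exp (i φ)`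
(projection from the south pole). -/
def unitVec (ξ : ℂ) : E3 :=
  !₂[2 * ξ.re / (1 + ‖ξ‖ ^ 2), 2 * ξ.im / (1 + ‖ξ‖ ^ 2), (1 - ‖ξ‖ ^ 2) / (1 + ‖ξ‖ ^ 2)]

/-- The point source at `(-l, 0, 0)`, parameterized by the direction `ξ` of its rays. -/
def pointSource (l : ℝ) (ξ : ℂ) : OrientedLine where
  base := !₂[-l, 0, 0]
  dir := unitVec ξ

/-- The directions `ξ` of those rays of the point source that hit the inside of the cylinder
(transversally, and not behind the source). -/
def reflectedDirs (a l : ℝ) : Set ℂ :=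
  {ξ | CrossesCylinder a (pointSource l ξ) ∧ 0 ≤ exitParam a (pointSource l ξ)}

/-- The line congruence of the `k`-th reflection of the point source off the inside of the
cylinder, parameterized by the initial direction `ξ`. -/
def kthReflection (a l : ℝ) (k : ℕ) (ξ : ℂ) : OrientedLine :=
  (cylReflect a)^[k] (pointSource l ξ)

/-- The focal surface of the `k`-th reflection. The focal set consists of a surface and of a curve
in the plane `x³ = 0`; the surface is the closure of the part of the focal set off this plane. -/
def focalSurface (a l : ℝ) (k : ℕ) : Set E3 :=
  closure {p | p ∈ focalSet (kthReflection a l k) (reflectedDirs a l) ∧ p 2 ≠ 0}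

/-- Translation by `t` along the axis of the cylinder. -/
def axisTranslation (t : ℝ) (p : E3) : E3 := p + !₂[0, 0, t]

/-- The direction `ξ = u * exp (i v)`. -/
def polarDir (u v : ℝ) : ℂ := (u : ℂ) * Complex.exp ((v : ℂ) * Complex.I)

end FocalCylinder

end

/-! Write `ξ = exp (x + i v)`, so `u = exp x`. The horizontal part of the ray then has direction `v`
and speed `1 / cosh x`, and its slope against horizontal length is `-sinh x`. The cylinder's normal
is horizontal, so reflection acts on the horizontal part as a circular billiard and keeps this
slope. With `w = r / cosh x`, the point on the reflected line is `B(v) + w (cos α(v), sin α(v))`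
horizontally, at height `-sinh x (L(v) + w)` (`kthReflection_exp`). The horizontal part does not
involve `x`, so the Jacobian splits into two factors. `L + w` comes from the height and vanishes
only in the plane `x³ = 0`. `cos α B₂' - sin α B₁' + w α'` is the Jacobian of the planar rays. Off
the plane, focal points are therefore the zeros of the second factor with `α' ≠ 0`
(`IsAxialJet.eq_of_isFocalAt`, `IsAxialJet.isFocalAt`), and their `w` depends on `v` alone. Since
`sinh` maps onto `ℝ`, the focal surface is the closure of the vertical cylinder over the planar
caustic (`focalSurface_eq`). Both claims follow. -/

namespace FocalCylinder

/-! ### Blow-up of the optical scalars and the gradient of the direction field -/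

/-- The derivative of `pointMap γ` at `(μ, r)`, in terms of the derivatives `b`, `d` of the base
point and of the direction, and of the direction `e`. -/
noncomputable def pointMapDeriv (b d : ℂ →L[ℝ] E3) (e : E3) (r : ℝ) : ℂ × ℝ →L[ℝ] E3 :=
  (b + r • d).comp (ContinuousLinearMap.fst ℝ ℂ ℝ) +
    (ContinuousLinearMap.snd ℝ ℂ ℝ).smulRight e

theorem pointMapDeriv_apply (b d : ℂ →L[ℝ] E3) (e : E3) (r : ℝ) (x : ℂ × ℝ) :
    pointMapDeriv b d e r x = b x.1 + r • d x.1 + x.2 • e := by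
  simp [pointMapDeriv]

theorem hasFDerivAt_pointMap {γ : ℂ → OrientedLine} {μ : ℂ} {b d : ℂ →L[ℝ] E3}
    (hb : HasFDerivAt (fun ν => (γ ν).base) b μ) (hd : HasFDerivAt (fun ν => (γ ν).dir) d μ)
    (r : ℝ) : HasFDerivAt (pointMap γ) (pointMapDeriv b d (γ μ).dir r) (μ, r) := by
  have h1 : HasFDerivAt (fun x : ℂ × ℝ => x.1) (ContinuousLinearMap.fst ℝ ℂ ℝ) (μ, r) :=
    hasFDerivAt_fst
  have h2 : HasFDerivAt (fun x : ℂ × ℝ => x.2) (ContinuousLinearMap.snd ℝ ℂ ℝ) (μ, r) :=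
    hasFDerivAt_snd
  have hb' : HasFDerivAt (fun x : ℂ × ℝ => (γ x.1).base) _ (μ, r) :=
    HasFDerivAt.comp (g := fun ν => (γ ν).base) (μ, r) hb h1
  have hd' : HasFDerivAt (fun x : ℂ × ℝ => (γ x.1).dir) _ (μ, r) :=
    HasFDerivAt.comp (g := fun ν => (γ ν).dir) (μ, r) hd h1
  refine (hb'.add (h2.smul hd')).congr_fderiv ?_
  ext x <;> simp [pointMapDeriv]

theorem gradDir_eq {γ : ℂ → OrientedLine} {μ : ℂ} {b d : ℂ →L[ℝ] E3}
    (hb : HasFDerivAt (fun ν => (γ ν).base) b μ) (hd : HasFDerivAt (fun ν => (γ ν).dir) d μ)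
    (r : ℝ) : gradDir γ μ r =
      d.comp ((ContinuousLinearMap.fst ℝ ℂ ℝ).comp (pointMapDeriv b d (γ μ).dir r).inverse) := by
  rw [gradDir, hd.fderiv, (hasFDerivAt_pointMap hb hd r).fderiv]

/-- Away from singular points of `pointMap γ`, the gradient of the direction field is continuous
along each line. -/
theorem continuousAt_gradDir {γ : ℂ → OrientedLine} {μ : ℂ} {b d : ℂ →L[ℝ] E3}
    (hb : HasFDerivAt (fun ν => (γ ν).base) b μ) (hd : HasFDerivAt (fun ν => (γ ν).dir) d μ)
    {r : ℝ} (hr : (pointMapDeriv b d (γ μ).dir r).IsInvertible) :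
    ContinuousAt (gradDir γ μ) r := by
  have h : gradDir γ μ = fun r => d.comp ((ContinuousLinearMap.fst ℝ ℂ ℝ).comp
      (pointMapDeriv b d (γ μ).dir r).inverse) := funext fun r => gradDir_eq hb hd r
  have hc : Continuous (pointMapDeriv b d (γ μ).dir) := by
    unfold pointMapDeriv
    fun_prop
  have hi : ContinuousAt ContinuousLinearMap.inverse (pointMapDeriv b d (γ μ).dir r) :=
    (hr.contDiffAt_map_inverse (n := 0)).continuousAt
  have := ContinuousAt.comp (f := pointMapDeriv b d (γ μ).dir) hi hc.continuousAt
  rw [h]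
  exact continuousAt_const.clm_comp (continuousAt_const.clm_comp this)

/-- `ρ` and `σ` are linear in the components of the gradient, so continuity gives them a finite
limit. -/
theorem not_isFocalAt_of_continuousAt {γ : ℂ → OrientedLine} {μ : ℂ} {r : ℝ}
    (h : ContinuousAt (gradDir γ μ) r) : ¬ IsFocalAt γ μ r := by
  rintro ⟨e₁, e₂, -, hlim⟩
  have hg : ∀ x y : E3, ContinuousAt (fun r' => gradComp γ μ r' x y) r := fun x y =>
    (h.clm_apply continuousAt_const).inner continuousAt_const
  have hg' : ∀ x y : E3, ContinuousAt (fun r' => (gradComp γ μ r' x y : ℂ)) r := fun x y =>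
    Complex.continuous_ofReal.continuousAt.comp (hg x y)
  have h11 := hg' e₁ e₁
  have h12 := hg' e₁ e₂
  have h21 := hg' e₂ e₁
  have h22 := hg' e₂ e₂
  have hc : ContinuousAt
      (fun r' => ‖(opticalRho γ e₁ e₂ μ r', opticalSigma γ e₁ e₂ μ r')‖) r := by
    simp only [opticalRho, opticalSigma, Complex.ofReal_add, Complex.ofReal_sub]
    fun_prop
  exact not_tendsto_nhds_of_tendsto_atTop hlim _ (hc.tendsto.mono_left nhdsWithin_le_nhds)

/-- The first diagonal component of the gradient bounds the optical scalars from below. -/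
theorem abs_gradComp_le (γ : ℂ → OrientedLine) (e₁ e₂ : E3) (μ : ℂ) (r : ℝ) :
    |gradComp γ μ r e₁ e₁| ≤ 2 * ‖(opticalRho γ e₁ e₂ μ r, opticalSigma γ e₁ e₂ μ r)‖ := by
  have h1 := norm_fst_le (opticalRho γ e₁ e₂ μ r, opticalSigma γ e₁ e₂ μ r)
  have h2 := norm_snd_le (opticalRho γ e₁ e₂ μ r, opticalSigma γ e₁ e₂ μ r)
  -- In the real part of `ρ + σ` the `e₂e₂` terms cancel.
  have h3 := norm_add_le (opticalRho γ e₁ e₂ μ r) (opticalSigma γ e₁ e₂ μ r)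
  have h4 := Complex.abs_re_le_norm (opticalRho γ e₁ e₂ μ r + opticalSigma γ e₁ e₂ μ r)
  have h5 : (opticalRho γ e₁ e₂ μ r + opticalSigma γ e₁ e₂ μ r).re =
      -gradComp γ μ r e₁ e₁ := by
    simp [opticalRho, opticalSigma]
    ring
  rw [h5, abs_neg] at h4
  simp only at h1 h2
  linarith

/-! ### Focal criterion from the factored Jacobian -/

/-- First-order data at `μ` of a line congruence whose directions and base points, in suitable
real coordinates with differentials `X`, `Y`, are
`(cos α(y) / cosh x, sin α(y) / cosh x, -sinh x / cosh x)` and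
`(B₁(y), B₂(y), -sinh x * L(y))`; here `C = cosh x` and `S = sinh x` at the given point. -/
structure IsAxialJet (γ : ℂ → OrientedLine) (μ : ℂ) (α C S L B₁' B₂' L' α' : ℝ)
    (X Y : ℂ →L[ℝ] ℝ) (b d : ℂ →L[ℝ] E3) : Prop where
  cosh_pos : 0 < C
  cosh_sq : C ^ 2 = 1 + S ^ 2
  coord : ∀ δ, X δ = 0 → Y δ = 0 → δ = 0
  dir_eq : (γ μ).dir = !₂[Real.cos α / C, Real.sin α / C, -S / C]
  base_deriv : HasFDerivAt (fun ν => (γ ν).base) b μ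
  dir_deriv : HasFDerivAt (fun ν => (γ ν).dir) d μ
  base_apply : ∀ δ, b δ = !₂[Y δ * B₁', Y δ * B₂', -(X δ * C * L + S * (Y δ * L'))]
  dir_apply : ∀ δ, d δ = !₂[-(Y δ * α' * Real.sin α / C) - X δ * Real.cos α * S / C ^ 2,
    Y δ * α' * Real.cos α / C - X δ * Real.sin α * S / C ^ 2, -X δ / C ^ 2]

namespace IsAxialJet

variable {γ : ℂ → OrientedLine} {μ : ℂ} {α C S L B₁' B₂' L' α' : ℝ}
  {X Y : ℂ →L[ℝ] ℝ} {b d : ℂ →L[ℝ] E3}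

/-- Both the direction and its `X`-derivative are horizontally parallel to `(cos α, sin α)`, so
pairing with the normal `(-sin α, cos α, 0)` leaves only the `Y` term. Its coefficient is the planar
factor of the Jacobian. -/
theorem deriv_normal (h : IsAxialJet γ μ α C S L B₁' B₂' L' α' X Y b d) (r : ℝ) (x : ℂ × ℝ) :
    -Real.sin α * pointMapDeriv b d (γ μ).dir r x 0
      + Real.cos α * pointMapDeriv b d (γ μ).dir r x 1 =
    Y x.1 * (Real.cos α * B₂' - Real.sin α * B₁' + r * α' / C) := by
  rw [pointMapDeriv_apply, h.dir_eq, h.base_apply, h.dir_apply]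
  simp
  linear_combination (r * Y x.1 * α' / C) * Real.sin_sq_add_cos_sq α

theorem isInvertible (h : IsAxialJet γ μ α C S L B₁' B₂' L' α' X Y b d) {r : ℝ}
    (hL : L + r / C ≠ 0) (hg : Real.cos α * B₂' - Real.sin α * B₁' + r * α' / C ≠ 0) :
    (pointMapDeriv b d (γ μ).dir r).IsInvertible := by
  have hinj : Function.Injective (pointMapDeriv b d (γ μ).dir r).toLinearMap := by
    refine (injective_iff_map_eq_zero _).2 fun x hx => ?_
    have hx : pointMapDeriv b d (γ μ).dir r x = 0 := hx
    have hY : Y x.1 = 0 := by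
      have := h.deriv_normal r x
      rw [hx] at this
      simpa [hg] using this
    have hC := h.cosh_pos.ne'
    have e0 := congrArg (fun p : E3 => p 0) hx
    have e1 := congrArg (fun p : E3 => p 1) hx
    have e2 := congrArg (fun p : E3 => p 2) hx
    rw [pointMapDeriv_apply, h.dir_eq, h.base_apply, h.dir_apply] at e0 e1 e2
    simp [hY] at e0 e1 e2
    field_simp at e0 e1 e2 hL
    -- With `Y = 0`, this component along `(cos α, sin α)` and the vertical one form a 2×2 system in
    -- `X x.1` and `x.2`, which is nonsingular because `C * L + r ≠ 0`.
    have e3 : x.2 * C - r * X x.1 * S = 0 := by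
      linear_combination Real.cos α * e0 + Real.sin α * e1
        - (x.2 * C - r * X x.1 * S) * Real.sin_sq_add_cos_sq α
    have hCL : C * L + r ≠ 0 := fun h0 => hL (by rw [h0, zero_div])
    have e4 : X x.1 * (C ^ 2 * (C * L + r)) = 0 := by
      linear_combination (-1) * e2 - S * e3 + X x.1 * r * h.cosh_sq
    have hX : X x.1 = 0 := by
      simpa [hC, hCL] using e4
    have hx2 : x.2 = 0 := by simpa [hX, hC] using e3
    exact Prod.ext (h.coord _ hX hY) hx2
  have hfin : Module.finrank ℝ (ℂ × ℝ) = Module.finrank ℝ E3 := by simp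
  exact ⟨(LinearEquiv.ofInjectiveOfFinrankEq _ hinj hfin).toContinuousLinearEquiv, by
    ext <;> rfl⟩

theorem not_isInvertible (h : IsAxialJet γ μ α C S L B₁' B₂' L' α' X Y b d) {r : ℝ}
    (hg : Real.cos α * B₂' - Real.sin α * B₁' + r * α' / C = 0) :
    ¬ (pointMapDeriv b d (γ μ).dir r).IsInvertible := by
  intro hT
  obtain ⟨x, hx⟩ := hT.surjective !₂[-Real.sin α, Real.cos α, 0]
  have := h.deriv_normal r x
  rw [hg, hx] at this
  simp at this
  nlinarith [Real.sin_sq_add_cos_sq α]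

/-- A focal point off the plane `x³ = 0` is a zero of the factor of the Jacobian that belongs to
the planar caustic. -/
theorem eq_of_isFocalAt (h : IsAxialJet γ μ α C S L B₁' B₂' L' α' X Y b d) {r : ℝ}
    (hL : L + r / C ≠ 0) (hf : IsFocalAt γ μ r) :
    α' ≠ 0 ∧ Real.cos α * B₂' - Real.sin α * B₁' + r * α' / C = 0 := by
  have hg : Real.cos α * B₂' - Real.sin α * B₁' + r * α' / C = 0 := by
    by_contra hg
    exact not_isFocalAt_of_continuousAt
      (continuousAt_gradDir h.base_deriv h.dir_deriv (h.isInvertible hL hg)) hf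
  -- If `α' = 0`, the planar factor does not depend on `r` and so vanishes along the whole line.
  -- `inverse` then takes its default value `0` everywhere, and the gradient is constantly `0`
  -- instead of blowing up.
  refine ⟨?_, hg⟩
  rintro rfl
  refine not_isFocalAt_of_continuousAt ?_ hf
  have : gradDir γ μ = fun _ => 0 := by
    funext s
    rw [gradDir_eq h.base_deriv h.dir_deriv, ContinuousLinearMap.inverse_of_not_isInvertible
      (h.not_isInvertible (by simpa using hg))]
    simp
  rw [this]
  exact continuousAt_const

theorem isFrame (h : IsAxialJet γ μ α C S L B₁' B₂' L' α' X Y b d) :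
    IsFrame (γ μ).dir !₂[-Real.sin α, Real.cos α, 0]
      !₂[S / C * Real.cos α, S / C * Real.sin α, 1 / C] := by
  have hC := h.cosh_pos.ne'
  have hsq := h.cosh_sq
  have hcs := Real.sin_sq_add_cos_sq α
  rw [h.dir_eq]
  constructor
  · have key : ∀ i j : Fin 3, inner ℝ
        ((![!₂[Real.cos α / C, Real.sin α / C, -S / C], !₂[-Real.sin α, Real.cos α, 0],
          !₂[S / C * Real.cos α, S / C * Real.sin α, 1 / C]] : Fin 3 → E3) i)
        ((![!₂[Real.cos α / C, Real.sin α / C, -S / C], !₂[-Real.sin α, Real.cos α, 0],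
          !₂[S / C * Real.cos α, S / C * Real.sin α, 1 / C]] : Fin 3 → E3) j) =
        if i = j then (1 : ℝ) else 0 := by
      intro i j
      rw [PiLp.inner_apply, Fin.sum_univ_three]
      simp only [RCLike.inner_apply, conj_trivial]
      fin_cases i <;> fin_cases j <;> simp <;> field_simp
      · linear_combination hcs - hsq
      · ring
      · linear_combination S * hcs
      · ring
      · linear_combination hcs
      · ring
      · linear_combination S * hcs
      · ring
      · linear_combination S ^ 2 * hcs - hsq
    exact orthonormal_iff_ite.2 key
  · rw [Matrix.det_fin_three]
    simp
    field_simp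
    linear_combination (1 + S ^ 2) * hcs - hsq

/-- By `deriv_normal`, the preimage of the horizontal normal has `Y` equal to the reciprocal of the
planar factor, and the normal component of `d` is `Y * α' / C`. -/
theorem gradComp_eq (h : IsAxialJet γ μ α C S L B₁' B₂' L' α' X Y b d) {r : ℝ}
    (hL : L + r / C ≠ 0) (hg : Real.cos α * B₂' - Real.sin α * B₁' + r * α' / C ≠ 0) :
    gradComp γ μ r !₂[-Real.sin α, Real.cos α, 0] !₂[-Real.sin α, Real.cos α, 0] =
      α' / C * (Real.cos α * B₂' - Real.sin α * B₁' + r * α' / C)⁻¹ := by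
  have hT := h.isInvertible hL hg
  have hx := hT.self_apply_inverse !₂[-Real.sin α, Real.cos α, 0]
  have hY := h.deriv_normal r
    ((pointMapDeriv b d (γ μ).dir r).inverse !₂[-Real.sin α, Real.cos α, 0])
  rw [hx] at hY
  have hY' : 1 = Y ((pointMapDeriv b d (γ μ).dir r).inverse !₂[-Real.sin α, Real.cos α, 0]).1 *
      (Real.cos α * B₂' - Real.sin α * B₁' + r * α' / C) := by
    rw [← hY]
    simp
    linear_combination (-1) * Real.sin_sq_add_cos_sq α
  rw [eq_comm, ← eq_mul_inv_iff_mul_eq₀ hg] at hY'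
  rw [gradComp, gradDir_eq h.base_deriv h.dir_deriv]
  simp only [ContinuousLinearMap.comp_apply, ContinuousLinearMap.coe_fst', h.dir_apply]
  rw [hY']
  simp [PiLp.inner_apply, Fin.sum_univ_three]
  linear_combination (α' / C * (Real.cos α * B₂' - Real.sin α * B₁' + r * α' / C)⁻¹) *
    Real.sin_sq_add_cos_sq α

theorem isFocalAt (h : IsAxialJet γ μ α C S L B₁' B₂' L' α' X Y b d) {r : ℝ}
    (hL : L + r / C ≠ 0) (hα : α' ≠ 0)
    (hg : Real.cos α * B₂' - Real.sin α * B₁' + r * α' / C = 0) : IsFocalAt γ μ r := by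
  have hC := h.cosh_pos.ne'
  refine ⟨_, _, h.isFrame, ?_⟩
  -- The planar factor is affine in the parameter with zero `r`, so the gradient component near `r`
  -- is exactly `1 / (r' - r)`.
  have hg0 : ∀ r', Real.cos α * B₂' - Real.sin α * B₁' + r' * α' / C = (r' - r) * (α' / C) := by
    intro r'
    linear_combination hg
  have hne : ∀ᶠ r' in 𝓝[≠] r, r' - r ≠ 0 := by
    filter_upwards [self_mem_nhdsWithin] with r' hr'
    exact sub_ne_zero.2 hr'
  have hLev : ∀ᶠ r' in 𝓝[≠] r, L + r' / C ≠ 0 := by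
    refine Filter.Eventually.filter_mono nhdsWithin_le_nhds ?_
    have : ContinuousAt (fun r' : ℝ => L + r' / C) r := by fun_prop
    exact this.eventually_ne hL
  have hlim : Tendsto (fun r' : ℝ => |(r' - r)⁻¹| / 2) (𝓝[≠] r) atTop := by
    have h0 : Tendsto (fun r' : ℝ => r' - r) (𝓝[≠] r) (𝓝[≠] 0) := by
      refine tendsto_nhdsWithin_iff.2 ⟨?_, hne⟩
      have : ContinuousAt (fun r' : ℝ => r' - r) r := by fun_prop
      simpa using this.tendsto.mono_left nhdsWithin_le_nhds
    exact ((tendsto_norm_inv_nhdsNE_zero_atTop (α := ℝ)).comp h0).atTop_div_const two_pos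
  refine tendsto_atTop_mono' _ ?_ hlim
  filter_upwards [hne, hLev] with r' h1 h2
  have hb := abs_gradComp_le γ !₂[-Real.sin α, Real.cos α, 0]
    !₂[S / C * Real.cos α, S / C * Real.sin α, 1 / C] μ r'
  have hα' : α' / C ≠ 0 := div_ne_zero hα hC
  have hg' : Real.cos α * B₂' - Real.sin α * B₁' + r' * α' / C ≠ 0 := by
    rw [hg0]
    exact mul_ne_zero h1 hα'
  rw [h.gradComp_eq h2 hg', hg0, mul_inv, mul_comm (r' - r)⁻¹, mul_inv_cancel_left₀ hα'] at hb
  linarith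

end IsAxialJet


/-! ### The reflected rays in closed form -/

/-- The signed angle of incidence of the horizontal ray with direction `v` from `(-l, 0)` on the
circle of radius `a`. -/
noncomputable def incidenceAngle (a l v : ℝ) : ℝ := Real.arcsin (-(l * Real.sin v) / a)

/-- The polar angle of the point of the circle at which the `n + 1`-st reflection takes place. -/
noncomputable def hitAngle (a l : ℝ) (n : ℕ) (v : ℝ) : ℝ :=
  v - incidenceAngle a l v + n * (Real.pi - 2 * incidenceAngle a l v)

/-- The polar angle of the horizontal direction after `n + 1` reflections. -/
noncomputable def outAngle (a l : ℝ) (n : ℕ) (v : ℝ) : ℝ :=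
  hitAngle a l n v + Real.pi - incidenceAngle a l v

/-- The horizontal path length from the source to the `n + 1`-st point of reflection. -/
noncomputable def pathLength (a l : ℝ) (n : ℕ) (v : ℝ) : ℝ :=
  l * Real.cos v + (2 * n + 1) * (a * Real.cos (incidenceAngle a l v))

/-- The horizontal ray with direction `v` lies on a line that crosses the circle. -/
def IsTransversal (a l v : ℝ) : Prop := (l * Real.sin v) ^ 2 < a ^ 2

variable {a l : ℝ}

theorem IsTransversal.mem_Ioo (ha : 0 < a) {v : ℝ} (h : IsTransversal a l v) :
    -1 < -(l * Real.sin v) / a ∧ -(l * Real.sin v) / a < 1 := by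
  have := abs_lt.1 (abs_lt_of_sq_lt_sq h ha.le)
  constructor
  · rw [lt_div_iff₀ ha]; linarith
  · rw [div_lt_iff₀ ha]; linarith

theorem IsTransversal.mul_sin (ha : 0 < a) {v : ℝ} (h : IsTransversal a l v) :
    a * Real.sin (incidenceAngle a l v) = -(l * Real.sin v) := by
  obtain ⟨h1, h2⟩ := h.mem_Ioo ha
  rw [incidenceAngle, Real.sin_arcsin h1.le h2.le]
  field_simp

theorem cos_incidenceAngle_nonneg (v : ℝ) : 0 ≤ Real.cos (incidenceAngle a l v) :=
  Real.cos_arcsin_nonneg _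

theorem IsTransversal.mul_cos (ha : 0 < a) {v : ℝ} (h : IsTransversal a l v) :
    √(a ^ 2 - (l * Real.sin v) ^ 2) = a * Real.cos (incidenceAngle a l v) := by
  have h1 : a ^ 2 - (l * Real.sin v) ^ 2 = (a * Real.cos (incidenceAngle a l v)) ^ 2 := by
    have := h.mul_sin ha
    linear_combination (a * Real.sin (incidenceAngle a l v) - l * Real.sin v) * this
      - a ^ 2 * Real.sin_sq_add_cos_sq (incidenceAngle a l v)
  rw [h1, Real.sqrt_sq (mul_nonneg ha.le (cos_incidenceAngle_nonneg v))]

theorem IsTransversal.differentiableAt (ha : 0 < a) {v : ℝ} (h : IsTransversal a l v) :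
    DifferentiableAt ℝ (incidenceAngle a l) v := by
  obtain ⟨h1, h2⟩ := h.mem_Ioo ha
  have := Real.differentiableAt_arcsin.2 ⟨h1.ne', h2.ne⟩
  exact DifferentiableAt.comp (g := Real.arcsin) v this (by fun_prop)

/-- For `u = exp x`, `2u / (1 + u²) = 1 / cosh x` and `(1 - u²) / (1 + u²) = -tanh x`. -/
theorem unitVec_exp (ζ : ℂ) : unitVec (Complex.exp ζ) =
    !₂[Real.cos ζ.im / Real.cosh ζ.re, Real.sin ζ.im / Real.cosh ζ.re,
      -Real.sinh ζ.re / Real.cosh ζ.re] := by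
  have h := Real.exp_pos ζ.re
  rw [unitVec, Complex.norm_exp, Complex.exp_re, Complex.exp_im, Real.cosh_eq, Real.sinh_eq,
    Real.exp_neg]
  ext i
  fin_cases i <;> simp <;> field_simp
  · ring
  · ring
  · ring

theorem hdot_dir_pointSource (l : ℝ) (ζ : ℂ) :
    hdot (pointSource l (Complex.exp ζ)).dir (pointSource l (Complex.exp ζ)).dir =
      1 / Real.cosh ζ.re ^ 2 := by
  have := (Real.cosh_pos ζ.re).ne'
  simp [pointSource, hdot, unitVec_exp]
  field_simp
  linear_combination Real.sin_sq_add_cos_sq ζ.im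

theorem cylDisc_pointSource (a l : ℝ) (ζ : ℂ) :
    cylDisc a (pointSource l (Complex.exp ζ)) =
      (a ^ 2 - (l * Real.sin ζ.im) ^ 2) / Real.cosh ζ.re ^ 2 := by
  have := (Real.cosh_pos ζ.re).ne'
  rw [cylDisc, hdot_dir_pointSource]
  simp [pointSource, hdot, unitVec_exp]
  field_simp
  linear_combination l ^ 2 * Real.sin_sq_add_cos_sq ζ.im

theorem exitParam_pointSource (a l : ℝ) (ζ : ℂ) :
    exitParam a (pointSource l (Complex.exp ζ)) =
      (l * Real.cos ζ.im + √(a ^ 2 - (l * Real.sin ζ.im) ^ 2)) * Real.cosh ζ.re := by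
  have hC := Real.cosh_pos ζ.re
  rw [exitParam, cylDisc_pointSource, hdot_dir_pointSource, Real.sqrt_div' _ (by positivity),
    Real.sqrt_sq hC.le]
  simp [pointSource, hdot, unitVec_exp]
  field_simp

/-- `ζ.re` enters the discriminant and the exit parameter only through positive factors, so
admissibility depends on `v` alone. -/
theorem exp_mem_reflectedDirs_iff (ζ : ℂ) : Complex.exp ζ ∈ reflectedDirs a l ↔
    IsTransversal a l ζ.im ∧ 0 ≤ l * Real.cos ζ.im + √(a ^ 2 - (l * Real.sin ζ.im) ^ 2) := by
  have hC := Real.cosh_pos ζ.re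
  have h1 : 0 < 1 / Real.cosh ζ.re ^ 2 := by positivity
  have h2 : 0 < Real.cosh ζ.re ^ 2 := by positivity
  simp only [reflectedDirs, CrossesCylinder, Set.mem_ofPred_eq, hdot_dir_pointSource,
    cylDisc_pointSource, exitParam_pointSource, h1, true_and, mul_nonneg_iff_left_nonneg_of_pos hC,
    div_pos_iff_of_pos_right h2, sub_pos, IsTransversal]

/-- Reflection at a wall point with polar angle `ψ` under the signed angle of incidence `β`. -/
theorem cylReflect_eq (ha : a ≠ 0) {γ : OrientedLine} {C S ψ β z : ℝ}
    (hdir : γ.dir = !₂[Real.cos (ψ + β) / C, Real.sin (ψ + β) / C, -S / C])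
    (hexit : γ.point (exitParam a γ) = !₂[a * Real.cos ψ, a * Real.sin ψ, z]) :
    cylReflect a γ = ⟨!₂[a * Real.cos ψ, a * Real.sin ψ, z],
      !₂[Real.cos (ψ + Real.pi - β) / C, Real.sin (ψ + Real.pi - β) / C, -S / C]⟩ := by
  have hn : cylNormal a !₂[a * Real.cos ψ, a * Real.sin ψ, z] =
      !₂[Real.cos ψ, Real.sin ψ, 0] := by
    simp [cylNormal, ha]
  have hi : inner ℝ γ.dir !₂[Real.cos ψ, Real.sin ψ, 0] = Real.cos β / C := by
    rw [hdir, PiLp.inner_apply, Fin.sum_univ_three, Real.cos_add, Real.sin_add]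
    simp
    linear_combination (Real.cos β / C) * Real.sin_sq_add_cos_sq ψ
  have e1 : ψ + Real.pi - β = (ψ - β) + Real.pi := by ring
  rw [cylReflect, hexit, hn, hi, hdir, e1, Real.cos_add_pi, Real.sin_add_pi, Real.cos_add,
    Real.sin_add, Real.cos_sub, Real.sin_sub]
  congr 1
  ext i
  fin_cases i <;> simp <;> ring

/-- The base point is on the wall, so one root is `0`. The other belongs to a chord of horizontal
length `2 a cos β`, traversed at horizontal speed `1 / C`. -/
theorem exitParam_chord (ha : 0 < a) {γ : OrientedLine} {C S ψ β z : ℝ} (hC : 0 < C)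
    (hβ : 0 ≤ Real.cos β) (hbase : γ.base = !₂[a * Real.cos ψ, a * Real.sin ψ, z])
    (hdir : γ.dir =
      !₂[Real.cos (ψ + Real.pi - β) / C, Real.sin (ψ + Real.pi - β) / C, -S / C]) :
    exitParam a γ = 2 * (a * Real.cos β) * C := by
  have hs := Real.sin_sq_add_cos_sq ψ
  have e1 : ψ + Real.pi - β = (ψ - β) + Real.pi := by ring
  rw [e1, Real.cos_add_pi, Real.sin_add_pi] at hdir
  have h1 : hdot γ.dir γ.dir = 1 / C ^ 2 := by
    simp [hdot, hdir]
    linear_combination (1 / C ^ 2) * Real.sin_sq_add_cos_sq (ψ - β)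
  have h2 : hdot γ.base γ.base = a ^ 2 := by
    simp [hdot, hbase]
    linear_combination a ^ 2 * hs
  have h3 : hdot γ.base γ.dir = -(a * Real.cos β / C) := by
    simp [hdot, hbase, hdir]
    rw [Real.cos_sub, Real.sin_sub]
    linear_combination (-(a * Real.cos β / C)) * hs
  have h4 : √(cylDisc a γ) = a * Real.cos β / C := by
    rw [cylDisc, h1, h2, h3, sub_self, mul_zero, sub_zero, neg_sq,
      Real.sqrt_sq (by positivity)]
  rw [exitParam, h4, h3, h1]
  field_simp
  ring

/-- All chords of a circular billiard path meet the wall at the same angle `β`: each further bounce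
adds `π - 2β` to the polar angle and `2 a cos β` to the horizontal length, while the slope stays
`-sinh x`. -/
theorem kthReflection_exp (ha : 0 < a) (n : ℕ) (ζ : ℂ) (h : IsTransversal a l ζ.im) :
    kthReflection a l (n + 1) (Complex.exp ζ) =
      ⟨!₂[a * Real.cos (hitAngle a l n ζ.im), a * Real.sin (hitAngle a l n ζ.im),
          -(Real.sinh ζ.re * pathLength a l n ζ.im)],
        !₂[Real.cos (outAngle a l n ζ.im) / Real.cosh ζ.re,
          Real.sin (outAngle a l n ζ.im) / Real.cosh ζ.re, -Real.sinh ζ.re / Real.cosh ζ.re]⟩ := by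
  have hC := Real.cosh_pos ζ.re
  have hsin := h.mul_sin ha
  have hcos := cos_incidenceAngle_nonneg (a := a) (l := l) ζ.im
  have hsv := Real.sin_sq_add_cos_sq ζ.im
  induction n with
  | zero =>
    have hexit := exitParam_pointSource a l ζ
    rw [h.mul_cos ha] at hexit
    refine cylReflect_eq ha.ne' ?_ ?_
    · simp [pointSource, unitVec_exp, hitAngle]
    · rw [hexit, OrientedLine.point]
      simp only [pointSource, unitVec_exp, hitAngle, pathLength, Nat.cast_zero, zero_mul, add_zero,
        mul_zero, zero_add, one_mul, Real.cos_sub, Real.sin_sub]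
      ext i
      fin_cases i <;> simp <;> field_simp
      · linear_combination l * hsv - Real.sin ζ.im * hsin
      · linear_combination Real.cos ζ.im * hsin
  | succ n ih =>
    set β := incidenceAngle a l ζ.im with hβ
    have hψ : hitAngle a l (n + 1) ζ.im = hitAngle a l n ζ.im + Real.pi - 2 * β := by
      simp [hitAngle, ← hβ]
      ring
    have hexit := exitParam_chord ha (γ := kthReflection a l (n + 1) (Complex.exp ζ))
      (ψ := hitAngle a l n ζ.im) (β := β) hC hcos (by rw [ih]) (by rw [ih]; rfl)
    have : kthReflection a l (n + 1 + 1) (Complex.exp ζ) =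
        cylReflect a (kthReflection a l (n + 1) (Complex.exp ζ)) :=
      Function.iterate_succ_apply' _ _ _
    rw [this]
    refine cylReflect_eq ha.ne' ?_ ?_
    · rw [ih, hψ]
      simp only [outAngle, ← hβ]
      have e : hitAngle a l n ζ.im + Real.pi - 2 * β + β =
        hitAngle a l n ζ.im + Real.pi - β := by ring
      rw [e]
    · rw [hexit, ih, OrientedLine.point, hψ]
      have e1 : hitAngle a l n ζ.im + Real.pi - 2 * β =
        (hitAngle a l n ζ.im - β) - β + Real.pi := by ring
      have e2 : hitAngle a l n ζ.im + Real.pi - β =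
        (hitAngle a l n ζ.im - β) + Real.pi := by ring
      have e3 : hitAngle a l n ζ.im = (hitAngle a l n ζ.im - β) + β := by ring
      simp only [outAngle, ← hβ, e1, e2, Real.cos_add_pi, Real.sin_add_pi]
      -- With hit angle `t + β`, the addition formulas turn the claim into a polynomial identity in
      -- the sines and cosines of `t` and `β`.
      generalize hitAngle a l n ζ.im - β = t at e3
      rw [e3, Real.cos_add, Real.sin_add, Real.cos_sub, Real.sin_sub]
      ext i
      fin_cases i <;> simp [pathLength, ← hβ] <;> field_simp <;> ring

/-! ### First-order data of the reflected congruence -/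

theorem hasFDerivAt_vec3 {f₀ f₁ f₂ : ℂ → ℝ} {f₀' f₁' f₂' : ℂ →L[ℝ] ℝ} {μ : ℂ}
    (h₀ : HasFDerivAt f₀ f₀' μ) (h₁ : HasFDerivAt f₁ f₁' μ) (h₂ : HasFDerivAt f₂ f₂' μ) :
    ∃ b : ℂ →L[ℝ] E3, HasFDerivAt (fun ν => (!₂[f₀ ν, f₁ ν, f₂ ν] : E3)) b μ ∧
      ∀ δ, b δ = !₂[f₀' δ, f₁' δ, f₂' δ] := by
  refine ⟨(EuclideanSpace.equiv (Fin 3) ℝ).symm.toContinuousLinearMap.comp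
    (ContinuousLinearMap.pi ![f₀', f₁', f₂']), ?_, ?_⟩
  · rw [← hasFDerivWithinAt_univ, hasFDerivWithinAt_euclidean]
    intro i
    rw [hasFDerivWithinAt_univ]
    fin_cases i
    · exact h₀
    · exact h₁
    · exact h₂
  · intro δ
    ext i
    fin_cases i <;> rfl

/-- Transversality is an open condition, so the closed form holds near `exp ζ` and can be
differentiated there. The local logarithm takes the value `ζ` itself, whatever its imaginary part;
`X` and `Y` are the real and imaginary parts of its differential. -/
theorem exists_isAxialJet (ha : 0 < a) (n : ℕ) (ζ : ℂ) (h : IsTransversal a l ζ.im) :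
    ∃ X Y b d, IsAxialJet (kthReflection a l (n + 1)) (Complex.exp ζ) (outAngle a l n ζ.im)
      (Real.cosh ζ.re) (Real.sinh ζ.re) (pathLength a l n ζ.im)
      (deriv (fun v => a * Real.cos (hitAngle a l n v)) ζ.im)
      (deriv (fun v => a * Real.sin (hitAngle a l n v)) ζ.im)
      (deriv (pathLength a l n) ζ.im) (deriv (outAngle a l n) ζ.im) X Y b d := by
  have hinc := h.differentiableAt ha
  have hhit : DifferentiableAt ℝ (hitAngle a l n) ζ.im := by
    unfold hitAngle
    fun_prop
  have hout : DifferentiableAt ℝ (outAngle a l n) ζ.im := by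
    unfold outAngle
    fun_prop
  have hlen : DifferentiableAt ℝ (pathLength a l n) ζ.im := by
    unfold pathLength
    fun_prop
  have hB₁ : DifferentiableAt ℝ (fun v => a * Real.cos (hitAngle a l n v)) ζ.im := by fun_prop
  have hB₂ : DifferentiableAt ℝ (fun v => a * Real.sin (hitAngle a l n v)) ζ.im := by fun_prop
  set μ := Complex.exp ζ with hμ
  have hμ0 : μ ≠ 0 := Complex.exp_ne_zero ζ
  -- a branch of the logarithm near `μ`
  let lam : ℂ → ℂ := fun ν => ζ + Complex.log (ν / μ)
  have hlam0 : lam μ = ζ := by simp [lam, hμ0]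
  have hlam : HasDerivAt lam μ⁻¹ μ := by
    have h1 : HasDerivAt (fun ν : ℂ => ν / μ) (1 / μ) μ := (hasDerivAt_id μ).div_const μ
    have h2 := (h1.clog (by simp [hμ0])).const_add ζ
    have e : 1 / μ / (μ / μ) = μ⁻¹ := by simp [hμ0]
    rwa [e] at h2
  have hexp : ∀ᶠ ν in 𝓝 μ, Complex.exp (lam ν) = ν := by
    filter_upwards [isOpen_ne.mem_nhds hμ0] with ν hν
    rw [Complex.exp_add, Complex.exp_log (div_ne_zero hν hμ0), ← hμ, mul_div_cancel₀ _ hμ0]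
  have htrans : ∀ᶠ ν in 𝓝 μ, IsTransversal a l (lam ν).im := by
    have hc : ContinuousAt (fun ν => (l * Real.sin (lam ν).im) ^ 2) μ := by
      have := hlam.continuousAt
      have h1 : ContinuousAt (fun ν => (lam ν).im) μ :=
        Complex.continuous_im.continuousAt.comp this
      exact ((Real.continuous_sin.continuousAt.comp h1).const_mul l).pow 2
    refine hc.eventually_lt continuousAt_const ?_
    simpa only [hlam0, IsTransversal] using h
  let D : ℂ →L[ℝ] ℂ := (ContinuousLinearMap.toSpanSingleton ℂ μ⁻¹).restrictScalars ℝ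
  have hD : HasFDerivAt lam D μ := hlam.hasFDerivAt.restrictScalars ℝ
  let X : ℂ →L[ℝ] ℝ := Complex.reCLM.comp D
  let Y : ℂ →L[ℝ] ℝ := Complex.imCLM.comp D
  have hX : HasFDerivAt (fun ν => (lam ν).re) X μ := Complex.reCLM.hasFDerivAt.comp μ hD
  have hY : HasFDerivAt (fun ν => (lam ν).im) Y μ := Complex.imCLM.hasFDerivAt.comp μ hD
  have cX : ∀ {f : ℝ → ℝ} {f' : ℝ}, HasDerivAt f f' ζ.re →
      HasFDerivAt (fun ν => f (lam ν).re) (f' • X) μ := fun {f f'} hf =>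
    HasDerivAt.comp_hasFDerivAt (h₂ := f) μ (by rwa [hlam0]) hX
  have cY : ∀ {f : ℝ → ℝ}, DifferentiableAt ℝ f ζ.im →
      HasFDerivAt (fun ν => f (lam ν).im) (deriv f ζ.im • Y) μ := fun {f} hf =>
    HasDerivAt.comp_hasFDerivAt (h₂ := f) μ (by rw [hlam0]; exact hf.hasDerivAt) hY
  have hC := (Real.cosh_pos ζ.re).ne'
  have hsinh := cX (Real.hasDerivAt_sinh ζ.re)
  have hsech := cX ((Real.hasDerivAt_cosh ζ.re).fun_inv hC)
  have hcos := (cY hout).cos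
  have hsin := (cY hout).sin
  obtain ⟨b, hb, hb'⟩ := hasFDerivAt_vec3 (cY hB₁) (cY hB₂) (hsinh.fun_mul (cY hlen)).fun_neg
  obtain ⟨d, hd, hd'⟩ := hasFDerivAt_vec3 (hcos.fun_mul hsech) (hsin.fun_mul hsech)
    (hsinh.fun_neg.fun_mul hsech)
  refine ⟨X, Y, b, d, Real.cosh_pos _, Real.cosh_sq' _, ?_, ?_, ?_, ?_, ?_, ?_⟩
  · intro δ h1 h2
    have : δ * μ⁻¹ = 0 := Complex.ext h1 h2
    simpa [hμ0] using this
  · rw [hμ, kthReflection_exp ha n ζ h]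
  · refine hb.congr_of_eventuallyEq ?_
    filter_upwards [hexp, htrans] with ν h1 h2
    have := kthReflection_exp ha n (lam ν) h2
    rw [h1] at this
    rw [this]
  · refine hd.congr_of_eventuallyEq ?_
    filter_upwards [hexp, htrans] with ν h1 h2
    have := kthReflection_exp ha n (lam ν) h2
    rw [h1] at this
    rw [this]
    simp only [div_eq_mul_inv]
  · intro δ
    rw [hb']
    ext i
    fin_cases i <;> simp [hlam0] <;> ring
  · intro δ
    rw [hd']
    have := Real.cosh_sq' ζ.re
    ext i
    fin_cases i <;> simp [hlam0] <;> field_simp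
    · ring
    · ring
    · linear_combination (-(X δ)) * this


/-! ### The planar caustic and the focal surface -/

/-- Signed distance from the `n + 1`-st reflection point to the focal point of the reflected
horizontal rays (meaningful if `deriv (outAngle a l n) v ≠ 0`). -/
noncomputable def causticDist (a l : ℝ) (n : ℕ) (v : ℝ) : ℝ :=
  -(Real.cos (outAngle a l n v) * deriv (fun v => a * Real.sin (hitAngle a l n v)) v
    - Real.sin (outAngle a l n v) * deriv (fun v => a * Real.cos (hitAngle a l n v)) v)
    / deriv (outAngle a l n) v

/-- The focal point of the reflected horizontal rays. -/
noncomputable def causticPoint (a l : ℝ) (n : ℕ) (v : ℝ) : ℝ × ℝ :=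
  (a * Real.cos (hitAngle a l n v) + causticDist a l n v * Real.cos (outAngle a l n v),
    a * Real.sin (hitAngle a l n v) + causticDist a l n v * Real.sin (outAngle a l n v))

/-- The horizontal rays near `v` have a focal point after `n + 1` reflections, and it is not at
distance `0` from the source along the reflected ray. -/
def HasCausticPoint (a l : ℝ) (n : ℕ) (v : ℝ) : Prop :=
  deriv (outAngle a l n) v ≠ 0 ∧ pathLength a l n v + causticDist a l n v ≠ 0

theorem kthReflection_exp_point (ha : 0 < a) (n : ℕ) {ζ : ℂ} (h : IsTransversal a l ζ.im)
    (r : ℝ) : (kthReflection a l (n + 1) (Complex.exp ζ)).point r =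
      !₂[a * Real.cos (hitAngle a l n ζ.im)
          + r / Real.cosh ζ.re * Real.cos (outAngle a l n ζ.im),
        a * Real.sin (hitAngle a l n ζ.im) + r / Real.cosh ζ.re * Real.sin (outAngle a l n ζ.im),
        -(Real.sinh ζ.re * (pathLength a l n ζ.im + r / Real.cosh ζ.re))] := by
  rw [kthReflection_exp ha n ζ h, OrientedLine.point]
  ext i
  fin_cases i <;> simp <;> ring

theorem eq_causticPoint (ha : 0 < a) (n : ℕ) {ζ : ℂ} (h : IsTransversal a l ζ.im) {p : E3}
    (hp : p ∈ focalPointsOn (kthReflection a l (n + 1)) (Complex.exp ζ)) (hp2 : p 2 ≠ 0) :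
    HasCausticPoint a l n ζ.im ∧ (p 0, p 1) = causticPoint a l n ζ.im := by
  obtain ⟨r, hr, rfl⟩ := hp
  obtain ⟨X, Y, b, d, hj⟩ := exists_isAxialJet ha n ζ h
  rw [kthReflection_exp_point ha n h] at hp2 ⊢
  -- The height is `-sinh x` times this sum, so `x³ ≠ 0` excludes the other factor of the Jacobian.
  have hL : pathLength a l n ζ.im + r / Real.cosh ζ.re ≠ 0 := by
    intro h0
    simp [h0] at hp2
  obtain ⟨h1, h2⟩ := hj.eq_of_isFocalAt hL hr
  have hw : r / Real.cosh ζ.re = causticDist a l n ζ.im := by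
    rw [causticDist, eq_div_iff h1]
    linear_combination h2
  rw [hw] at hL
  refine ⟨⟨h1, hL⟩, ?_⟩
  rw [hw]
  rfl

theorem causticPoint_mem (ha : 0 < a) (n : ℕ) {ζ : ℂ} (h : IsTransversal a l ζ.im)
    (hv : HasCausticPoint a l n ζ.im) :
    (!₂[(causticPoint a l n ζ.im).1, (causticPoint a l n ζ.im).2,
      -(Real.sinh ζ.re * (pathLength a l n ζ.im + causticDist a l n ζ.im))] : E3) ∈
    focalPointsOn (kthReflection a l (n + 1)) (Complex.exp ζ) := by
  obtain ⟨X, Y, b, d, hj⟩ := exists_isAxialJet ha n ζ h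
  have hC := (Real.cosh_pos ζ.re).ne'
  have hr : causticDist a l n ζ.im * Real.cosh ζ.re / Real.cosh ζ.re = causticDist a l n ζ.im :=
    mul_div_cancel_right₀ _ hC
  refine ⟨causticDist a l n ζ.im * Real.cosh ζ.re, ?_, ?_⟩
  · refine hj.isFocalAt (by rw [hr]; exact hv.2) hv.1 ?_
    rw [mul_right_comm, mul_div_assoc, div_self hC, mul_one, causticDist, div_mul_cancel₀ _ hv.1]
    ring
  · rw [kthReflection_exp_point ha n h, hr]
    rfl

/-- A set of the form `{p | (p¹, p²) ∈ Q}` is in the closure of its part off the plane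
`x³ = 0`. -/
theorem closure_cylinder_off_plane (Q : Set (ℝ × ℝ)) :
    closure {p : E3 | (p 0, p 1) ∈ Q ∧ p 2 ≠ 0} = closure {p : E3 | (p 0, p 1) ∈ Q} := by
  refine subset_antisymm (closure_mono fun p hp => hp.1)
    (closure_minimal (fun p hp => ?_) isClosed_closure)
  by_cases h : p 2 = 0
  -- A point in the plane is the limit of its vertical translates, which keep the first two
  -- coordinates.
  · have hc : Continuous (fun t : ℝ => axisTranslation t p) := by
      refine continuous_const.add ((PiLp.continuous_toLp 2 _).comp (continuous_pi fun i => ?_))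
      fin_cases i
      · exact continuous_const
      · exact continuous_const
      · exact continuous_id
    have hlim : Tendsto (fun t : ℝ => axisTranslation t p) (𝓝[≠] 0) (𝓝 p) := by
      have h0 : axisTranslation 0 p = p := by
        ext i
        fin_cases i <;> simp [axisTranslation]
      have := (hc.tendsto 0).mono_left (nhdsWithin_le_nhds (s := {0}ᶜ))
      rwa [h0] at this
    refine mem_closure_of_tendsto hlim ?_
    filter_upwards [self_mem_nhdsWithin] with t ht
    have ht' : t ≠ 0 := ht
    constructor
    · simpa [axisTranslation] using hp
    · simpa [axisTranslation, h] using ht'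
  · exact subset_closure ⟨hp, h⟩

theorem axisTranslation_image_closure_cylinder (Q : Set (ℝ × ℝ)) (t : ℝ) :
    axisTranslation t '' closure {p : E3 | (p 0, p 1) ∈ Q} =
      closure {p : E3 | (p 0, p 1) ∈ Q} := by
  have h1 : axisTranslation t = Homeomorph.addRight (!₂[0, 0, t] : E3) := rfl
  rw [h1, Homeomorph.image_closure, Homeomorph.image_eq_preimage_symm]
  congr 1
  ext p
  have h2 : (Homeomorph.addRight (!₂[0, 0, t] : E3)).symm p = p + -!₂[0, 0, t] := rfl
  simp [h2]

/-- Only `ξ = 0` is not an exponential, and that ray is parallel to the axis. -/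
theorem exists_exp_eq_of_mem_reflectedDirs {ξ : ℂ} (h : ξ ∈ reflectedDirs a l) :
    ∃ ζ, Complex.exp ζ = ξ := by
  refine ⟨Complex.log ξ, Complex.exp_log ?_⟩
  rintro rfl
  have := h.1.1
  simp [pointSource, unitVec, hdot] at this

theorem focalSurface_eq (ha : 0 < a) (n : ℕ) : focalSurface a l (n + 1) =
    closure {p : E3 | (p 0, p 1) ∈ causticPoint a l n '' {v | IsTransversal a l v ∧
      0 ≤ l * Real.cos v + √(a ^ 2 - (l * Real.sin v) ^ 2) ∧ HasCausticPoint a l n v}} := by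
  rw [← closure_cylinder_off_plane, focalSurface]
  congr 1
  ext p
  constructor
  · rintro ⟨⟨ξ, hξ, hp⟩, hp2⟩
    obtain ⟨ζ, rfl⟩ := exists_exp_eq_of_mem_reflectedDirs hξ
    obtain ⟨h1, h2⟩ := (exp_mem_reflectedDirs_iff ζ).1 hξ
    obtain ⟨h3, h4⟩ := eq_causticPoint ha n h1 hp hp2
    exact ⟨⟨ζ.im, ⟨h1, h2, h3⟩, h4.symm⟩, hp2⟩
  · rintro ⟨⟨v, ⟨h1, h2, h3⟩, h4⟩, hp2⟩
    -- Solves the height equation for `log u`, so every height over a caustic point is attained.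
    let s := Real.arsinh (-p 2 / (pathLength a l n v + causticDist a l n v))
    have hs : p 2 = -(Real.sinh s * (pathLength a l n v + causticDist a l n v)) := by
      rw [Real.sinh_arsinh, div_mul_cancel₀ _ h3.2, neg_neg]
    refine ⟨⟨Complex.exp ⟨s, v⟩, (exp_mem_reflectedDirs_iff _).2 ⟨h1, h2⟩, ?_⟩, hp2⟩
    have := causticPoint_mem (ζ := ⟨s, v⟩) ha n h1 h3
    convert this using 1
    ext i
    fin_cases i
    · simp [h4]
    · simp [h4]
    · exact hs

theorem polarDir_eq_exp {u : ℝ} (hu : 0 < u) (v : ℝ) :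
    polarDir u v = Complex.exp ⟨Real.log u, v⟩ := by
  have h : (⟨Real.log u, v⟩ : ℂ) = (Real.log u : ℂ) + v * Complex.I := by
    apply Complex.ext <;> simp
  rw [h, Complex.exp_add, ← Complex.ofReal_exp, Real.exp_log hu, polarDir]

end FocalCylinder

theorem corollary2 (a l : ℝ) (ha : 0 < a) (hl : 0 ≤ l) (k : ℕ) (hk : 1 ≤ k) :
    (∀ t : ℝ, FocalCylinder.axisTranslation t '' FocalCylinder.focalSurface a l k =
      FocalCylinder.focalSurface a l k) ∧
    (∀ u u' v : ℝ, 0 < u → 0 < u' →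
      FocalCylinder.polarDir u v ∈ FocalCylinder.reflectedDirs a l →
      ∀ p ∈ FocalCylinder.focalPointsOn (FocalCylinder.kthReflection a l k)
          (FocalCylinder.polarDir u v), p 2 ≠ 0 →
        FocalCylinder.polarDir u' v ∈ FocalCylinder.reflectedDirs a l ∧
        (∃ p' ∈ FocalCylinder.focalPointsOn (FocalCylinder.kthReflection a l k)
          (FocalCylinder.polarDir u' v), p' 0 = p 0 ∧ p' 1 = p 1 ∧ (u' ≠ 1 → p' 2 ≠ 0)) ∧
        (∀ p' ∈ FocalCylinder.focalPointsOn (FocalCylinder.kthReflection a l k)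
          (FocalCylinder.polarDir u' v), p' 2 ≠ 0 → p' 0 = p 0 ∧ p' 1 = p 1)) := by
  obtain ⟨n, rfl⟩ : ∃ n, k = n + 1 := ⟨k - 1, by omega⟩
  constructor
  · intro t
    rw [FocalCylinder.focalSurface_eq ha,
      FocalCylinder.axisTranslation_image_closure_cylinder]
  · intro u u' v hu hu' hξ p hp hp2
    rw [FocalCylinder.polarDir_eq_exp hu] at hξ hp
    rw [FocalCylinder.polarDir_eq_exp hu']
    have hmem := (FocalCylinder.exp_mem_reflectedDirs_iff _).1 hξ
    have hv : FocalCylinder.IsTransversal a l v := hmem.1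
    obtain ⟨hc, hpc⟩ := FocalCylinder.eq_causticPoint ha n hmem.1 hp hp2
    replace hpc : (p 0, p 1) = FocalCylinder.causticPoint a l n v := hpc
    -- `hmem` involves only the imaginary part `v`, so it serves for `u'` as well.
    refine ⟨(FocalCylinder.exp_mem_reflectedDirs_iff _).2 hmem,
      ⟨_, FocalCylinder.causticPoint_mem ha n hv hc, ?_, ?_, ?_⟩, ?_⟩
    · exact (congrArg Prod.fst hpc).symm
    · exact (congrArg Prod.snd hpc).symm
    · intro h1
      -- The height carries the factor `sinh (log u')`, which vanishes only for `u' = 1`.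
      refine neg_ne_zero.2 (mul_ne_zero ?_ hc.2)
      exact fun h0 => Real.log_ne_zero_of_pos_of_ne_one hu' h1 (Real.sinh_eq_zero.1 h0)
    · intro p' hp' hp2'
      obtain ⟨-, hpc'⟩ := FocalCylinder.eq_causticPoint (ζ := ⟨Real.log u', v⟩) ha n hv hp' hp2'
      replace hpc' : (p' 0, p' 1) = FocalCylinder.causticPoint a l n v := hpc'
      exact Prod.ext_iff.1 (hpc'.trans hpc.symm)
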